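/- Let $G=(V,E)$ be a finite simple undirected graph with $n=|V|$ vertices and maximum degree at most $D$, and let $h>0$, $B>0$, $\beta\ge 0$. For $f\in\mathbb{C}^V$ put $$N(f)=\sum_{x\in V}|f_x|^2,\qquad H(f)=\frac{2}{n}\sum_{\{x,y\}\in E}\left|\frac{f_x-f_y}{h}\right|^2-\frac1n\sum_{x\in V}|f_x|^4,$$ where each edge is counted once, and $$Z=\int_{\mathbb{C}^V}e^{-\beta H(f)}\,1_{\{N(f)\le Bn\}}\,\prod_{x\in V}df_x$$ (Lebesgue measure on $\mathbb{C}^V$). For $\theta\ge 2$ let $$m(\theta)=\frac\theta2-\frac12+\frac\theta2\sqrt{1-\frac2\theta}+\log\left(\frac12-\frac12\sqrt{1-\frac2\theta}\right).$$ Theorem 2.1. (i) The function $m$ has exactly one zero $\theta_c$ in $[2,\infty)$, and $|\theta_c-2.455407|<10^{-6}$. Let $F(\beta,B)=\log(B\pi e)$ if $\beta B^2\le\theta_c$ and $F(\beta,B)=\log(B\pi e)+m(\beta B^2)$ if $\beta B^2>\theta_c$. (ii) Let $\beta\ge0$, $B>0$, $\epsilon\in(0,1/5)$ and $D\in\{0,1,2,\dots\}$.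 There is a constant $C>0$ depending only on $\epsilon,\beta,B,D$ such that for all $G$ and $h$ as above with $n>C$, $$\frac{\log Z}{n}-F(\beta,B)\ge -Cn^{-1/5}-C(nh^2)^{-1}$$ and $$\frac{\log Z}{n}-F(\beta,B)\le\begin{cases}Cn^{-1/5+\epsilon}+Cn^{-4\epsilon/5}&\text{if }\beta B^2\le\theta_c,\\ Cn^{-1/5+\epsilon}&\text{if }\beta B^2>\theta_c.\end{cases}$$ (iii) Consequently, for fixed $\beta\ge0$, $B>0$ and $D$, along any sequence of such graphs and spacings $h>0$ with $n\to\infty$ and $nh^2\to\infty$, one has $\dfrac{\log Z}{n}\to F(\beta,B)$. -/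

import Mathlib

open Filter Topology MeasureTheory

noncomputable section

namespace DiscreteNLS

/-- The kinetic contribution `|(f x - f y) / h|²` of the unordered pair `{x, y}`. -/
def edgeEnergy {V : Type*} (h : ℝ) (f : V → ℂ) : Sym2 V → ℝ :=
  Sym2.lift ⟨fun x y => ‖(f x - f y) / (h : ℂ)‖ ^ 2, fun x y => by
    simp only [norm_div, norm_sub_rev (f x) (f y)]⟩

/-- The power `N(f) = ∑ₓ |f x|²`. -/
def power {V : Type*} [Fintype V] (f : V → ℂ) : ℝ :=
  ∑ x, ‖f x‖ ^ 2

/-- The Hamiltonian of the focusing cubic discrete NLS on `G` with spacing `h`; the first sum is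
over the undirected edges of `G`, each taken once. -/
def hamiltonian {V : Type*} [Fintype V] (G : SimpleGraph V) [Fintype G.edgeSet]
    (h : ℝ) (f : V → ℂ) : ℝ :=
  2 / (Fintype.card V : ℝ) * ∑ e ∈ G.edgeFinset, edgeEnergy h f e
    - 1 / (Fintype.card V : ℝ) * ∑ x, ‖f x‖ ^ 4

/-- The partition function: the integral of `exp (-β H(f))` over `{f | N(f) ≤ B n}` with respect to
Lebesgue measure on `ℂ^V`. -/
def partitionFunction {V : Type*} [Fintype V] (G : SimpleGraph V) [Fintype G.edgeSet]
    (h β B : ℝ) : ℝ :=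
  ∫ f in {f : V → ℂ | power f ≤ B * (Fintype.card V : ℝ)}, Real.exp (-β * hamiltonian G h f)

/-- The function `m`, of which only the values on `[2, ∞)` are used. -/
def m (θ : ℝ) : ℝ :=
  θ / 2 - 1 / 2 + θ / 2 * √(1 - 2 / θ) + Real.log (1 / 2 - 1 / 2 * √(1 - 2 / θ))

/-- The critical value `θ_c`: the zero of `m` in `[2, ∞)`. -/
def thetaC : ℝ := sInf {θ : ℝ | 2 ≤ θ ∧ m θ = 0}

/-- The limiting free energy `F(β, B)`. -/
def freeEnergy (β B : ℝ) : ℝ :=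
  if β * B ^ 2 ≤ thetaC then Real.log (B * Real.pi * Real.exp 1)
  else Real.log (B * Real.pi * Real.exp 1) + m (β * B ^ 2)

end DiscreteNLS

end

/-!
The kinetic energy is nonnegative and, on `N(f) ≤ B n`, at most `4 D B / h²`; so up to an error of
order `(n h²)⁻¹` per site the graph disappears, and `log Z / n` is governed by the integral of
`exp ((β / n) ∑ |f x|⁴)` over a ball. If a fraction `1 - u` of the power sits on a few sites, the
remaining sites contribute entropy `log (B π e) + log u` per site and the few sites an energy of at
most `β B² (1 - u)²`, with equality for a single peak. The free energy is therefore
`log (B π e)` plus the supremum of `log u + θ (1 - u)²` over `u ∈ (0, 1]`, where `θ = β B²`.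

*The variational problem* (`log_add_le_excess`). The supremum is the larger of `0`, at `u = 1`, and
the value at the smaller root `u = lightFraction θ` of `2 θ u (1 - u) = 1`, which is `m θ`. As a
function of `u` this value is `1 / (2 u) - 1 / 2 + log u`, which is strictly decreasing on
`(0, 1 / 2]`, while `lightFraction` is strictly decreasing on `[2, ∞)`; so `m` is strictly increasing
and changes sign once.

*The upper bound* (`partitionFunction_le`). At most `k` sites carry more than `B n / (k + 1)`.
For each set `S` of `k` sites containing these, and each value of the power on `S` rounded to a
multiple of `B`, the Boltzmann factor is dominated by an explicit Gaussian weight, with a large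
variance on `S` and the variance dictated by the light fraction elsewhere. There are at most
`n ^ k * n` such weights, and with `k ≈ √n` the total error per site is of order `n^(-1/2) log n`.

*The lower bound*. The volume of the ball gives `log (B π e)`
(`le_log_partitionFunction_of_ball`). Above the critical value, a ball of power
`lightFraction θ * B n` is translated by a peak at one site
(`le_log_partitionFunction_of_peak`); the site is chosen so that a fraction `1 / n` of the ball
consists of fields that are small there, and the errors per site are again of order at most
`n^(-1/2) log n`.
-/

namespace DiscreteNLS

/-! ### The function `m` and its zero -/

/-- The smaller root `u` of `2 θ u (1 - u) = 1`: the fraction of the power that stays spread out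
over the graph when the rest sits on a single site. -/
noncomputable def lightFraction (θ : ℝ) : ℝ := 1 / 2 - 1 / 2 * √(1 - 2 / θ)

lemma lightFraction_le_half (θ : ℝ) : lightFraction θ ≤ 1 / 2 := by
  have := Real.sqrt_nonneg (1 - 2 / θ)
  unfold lightFraction
  linarith

lemma lightFraction_pos {θ : ℝ} (hθ : 2 ≤ θ) : 0 < lightFraction θ := by
  have h1 : √(1 - 2 / θ) < 1 := by
    rw [Real.sqrt_lt' one_pos]
    have : 0 < 2 / θ := by positivity
    linarith
  unfold lightFraction
  linarith

lemma two_mul_lightFraction_mul {θ : ℝ} (hθ : 2 ≤ θ) :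
    2 * θ * lightFraction θ * (1 - lightFraction θ) = 1 := by
  have h0 : 0 < θ := by linarith
  have h1 : 0 ≤ 1 - 2 / θ := by
    rw [sub_nonneg, div_le_one h0]
    exact hθ
  have h2 := Real.sq_sqrt h1
  have h3 : θ * (2 / θ) = 2 := by field_simp
  unfold lightFraction
  linear_combination (-θ / 2) * h2 + (1 / 2) * h3

lemma lightFraction_strictAntiOn : StrictAntiOn lightFraction (Set.Ici 2) := by
  intro a ha b hb hab
  have ha' := two_mul_lightFraction_mul ha
  have hb' := two_mul_lightFraction_mul hb
  have hb0 := lightFraction_pos hb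
  have ha1 := lightFraction_le_half a
  have hb1 := lightFraction_le_half b
  by_contra! hle
  have hprod : 0 < lightFraction b * (1 - lightFraction b) := mul_pos hb0 (by linarith)
  have hmono : lightFraction a * (1 - lightFraction a) ≤ lightFraction b * (1 - lightFraction b) := by
    nlinarith
  have : 0 < (2 : ℝ) := two_pos
  have ha2 : (2 : ℝ) ≤ a := ha
  nlinarith

/-- `m θ` is the value at the critical point of the variational problem. -/
lemma m_eq_log_add {θ : ℝ} (hθ : 2 ≤ θ) :
    m θ = Real.log (lightFraction θ) + θ * (1 - lightFraction θ) ^ 2 := by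
  have h0 : 0 < θ := by linarith
  have h1 : 0 ≤ 1 - 2 / θ := by
    rw [sub_nonneg, div_le_one h0]
    exact hθ
  have h2 := Real.sq_sqrt h1
  have h3 : θ * (2 / θ) = 2 := by field_simp
  unfold m lightFraction
  linear_combination (-θ / 4) * h2 + (1 / 4) * h3

/-- `m` as a function of the light fraction. -/
noncomputable def lightEnergy (u : ℝ) : ℝ := 1 / (2 * u) - 1 / 2 + Real.log u

lemma m_eq_lightEnergy {θ : ℝ} (hθ : 2 ≤ θ) : m θ = lightEnergy (lightFraction θ) := by
  rw [m_eq_log_add hθ, lightEnergy]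
  have h1 := two_mul_lightFraction_mul hθ
  have h2 := (lightFraction_pos hθ).ne'
  generalize lightFraction θ = u at *
  have h3 : 1 / (2 * u) = θ * (1 - u) := by
    field_simp
    linarith
  rw [h3]
  linear_combination (-1 / 2) * h1

lemma lightEnergy_strictAntiOn : StrictAntiOn lightEnergy (Set.Ioc 0 (1 / 2)) := by
  have hder : ∀ x : ℝ, 0 < x → HasDerivAt lightEnergy (-(2 * 1) / (2 * x) ^ 2 + x⁻¹) x := by
    intro x hx
    have h1 : HasDerivAt (fun x : ℝ => 1 / (2 * x)) (-(2 * 1) / (2 * x) ^ 2) x := by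
      simp only [one_div]
      exact ((hasDerivAt_id x).const_mul 2).inv (by simpa using hx.ne')
    exact (h1.sub_const _).add (Real.hasDerivAt_log hx.ne')
  apply strictAntiOn_of_deriv_neg (convex_Ioc 0 (1 / 2))
  · exact fun x hx => (hder x hx.1).continuousAt.continuousWithinAt
  · intro x hx
    rw [interior_Ioc] at hx
    rw [(hder x hx.1).deriv]
    have hx0 := hx.1
    have hx1 := hx.2
    have : -(2 * 1) / (2 * x) ^ 2 + x⁻¹ = -((1 - 2 * x) / (2 * x ^ 2)) := by
      field_simp
      ring
    rw [this, neg_lt_zero]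
    exact div_pos (by linarith) (by positivity)

lemma m_strictMonoOn : StrictMonoOn m (Set.Ici 2) := by
  intro a ha b hb hab
  rw [m_eq_lightEnergy ha, m_eq_lightEnergy hb]
  exact lightEnergy_strictAntiOn ⟨lightFraction_pos hb, lightFraction_le_half b⟩
    ⟨lightFraction_pos ha, lightFraction_le_half a⟩ (lightFraction_strictAntiOn ha hb hab)

lemma m_continuousOn : ContinuousOn m (Set.Ici 2) := by
  intro θ hθ
  have h0 : θ ≠ 0 := by
    have : (2 : ℝ) ≤ θ := hθ
    positivity
  have h1 : (1 / 2 - 1 / 2 * √(1 - 2 / θ)) ≠ 0 := (lightFraction_pos hθ).ne'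
  apply ContinuousAt.continuousWithinAt
  unfold m
  fun_prop (disch := assumption)

lemma m_lower_endpoint_neg : m 2.455406 < 0 := by
  have h2 : (2 : ℝ) ≤ 2.455406 := by norm_num
  rw [m_eq_lightEnergy h2]
  have hu : 0.2846684 ≤ lightFraction 2.455406 := by
    have : √(1 - 2 / 2.455406) ≤ 1 - 2 * 0.2846684 := by
      rw [Real.sqrt_le_left (by norm_num)]
      norm_num
    unfold lightFraction
    linarith
  refine (lightEnergy_strictAntiOn.antitoneOn (by constructor <;> norm_num)
    ⟨lightFraction_pos h2, lightFraction_le_half _⟩ hu).trans_lt ?_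
  -- `log 0.2846684` is computed from `log 2` and the Taylor series of `log (1 - x)`
  have hlog : Real.log 0.2846684 = Real.log (1 - (-0.1386736)) - 2 * Real.log 2 := by
    rw [← Real.log_rpow two_pos, ← Real.log_div (by norm_num) (by norm_num)]
    norm_num
  have hs := (abs_le.1 (Real.abs_log_sub_add_sum_range_le (x := -0.1386736)
    (by rw [abs_lt]; norm_num) 10)).2
  rw [abs_of_neg (by norm_num)] at hs
  have hl := Real.log_two_gt_d9
  rw [lightEnergy, hlog]
  norm_num [Finset.sum_range_succ] at hs hl ⊢
  linarith

lemma m_upper_endpoint_pos : 0 < m 2.455408 := by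
  have h2 : (2 : ℝ) ≤ 2.455408 := by norm_num
  rw [m_eq_lightEnergy h2]
  have hu : lightFraction 2.455408 ≤ 0.28466806 := by
    have : 1 - 2 * 0.28466806 ≤ √(1 - 2 / 2.455408) := by
      apply Real.le_sqrt_of_sq_le
      norm_num
    unfold lightFraction
    linarith
  refine lt_of_lt_of_le ?_ (lightEnergy_strictAntiOn.antitoneOn
    ⟨lightFraction_pos h2, lightFraction_le_half _⟩ (by constructor <;> norm_num) hu)
  have hlog : Real.log 0.28466806 = Real.log (1 - (-0.13867224)) - 2 * Real.log 2 := by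
    rw [← Real.log_rpow two_pos, ← Real.log_div (by norm_num) (by norm_num)]
    norm_num
  have hs := (abs_le.1 (Real.abs_log_sub_add_sum_range_le (x := -0.13867224)
    (by rw [abs_lt]; norm_num) 10)).1
  rw [abs_of_neg (by norm_num)] at hs
  have hl := Real.log_two_lt_d9
  rw [lightEnergy, hlog]
  norm_num [Finset.sum_range_succ] at hs hl ⊢
  linarith

lemma exists_m_eq_zero : ∃ θ : ℝ, 2.455406 < θ ∧ θ < 2.455408 ∧ m θ = 0 := by
  obtain ⟨θ, hθ, h0⟩ := intermediate_value_Ioo (by norm_num)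
    (m_continuousOn.mono fun x hx => show (2 : ℝ) ≤ x from le_trans (by norm_num) hx.1)
    (show (0 : ℝ) ∈ Set.Ioo (m 2.455406) (m 2.455408) from
      ⟨m_lower_endpoint_neg, m_upper_endpoint_pos⟩)
  exact ⟨θ, hθ.1, hθ.2, h0⟩

lemma eq_thetaC_of_m_eq_zero {θ : ℝ} (hθ : 2 ≤ θ) (h0 : m θ = 0) : θ = thetaC := by
  have : {x : ℝ | 2 ≤ x ∧ m x = 0} = {θ} := by
    ext x
    refine ⟨fun hx => m_strictMonoOn.injOn hx.1 hθ (hx.2.trans h0.symm), ?_⟩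
    rintro rfl
    exact ⟨hθ, h0⟩
  rw [thetaC, this, csInf_singleton]

lemma thetaC_spec : 2.455406 < thetaC ∧ thetaC < 2.455408 ∧ m thetaC = 0 := by
  obtain ⟨θ, h1, h2, h0⟩ := exists_m_eq_zero
  rwa [← eq_thetaC_of_m_eq_zero (by linarith) h0, and_iff_right h1, and_iff_right h2]

lemma two_le_thetaC : 2 ≤ thetaC := by
  linarith [thetaC_spec.1]

/-! ### The variational problem -/

/-- Beyond the critical value, `m θ` bounds the entropy plus energy of every splitting of the power
into a light fraction `v` and a concentrated fraction `1 - v`: in `v` the functional increases up to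
`lightFraction θ`, decreases up to `1 - lightFraction θ`, and then increases to `0` at `v = 1`. -/
lemma log_add_le_m {θ v : ℝ} (hθ : thetaC ≤ θ) (hv0 : 0 < v) (hv1 : v ≤ 1) :
    Real.log v + θ * (1 - v) ^ 2 ≤ m θ := by
  have h2 : 2 ≤ θ := two_le_thetaC.trans hθ
  have hm : 0 ≤ m θ := by
    rw [← thetaC_spec.2.2]
    exact m_strictMonoOn.monotoneOn two_le_thetaC h2 hθ
  have hmu := m_eq_log_add h2
  have hu0 := lightFraction_pos h2
  have hu1 := lightFraction_le_half θ
  have hu := two_mul_lightFraction_mul h2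
  set u := lightFraction θ
  let ψ : ℝ → ℝ := fun x => Real.log x + θ * (1 - x) ^ 2
  have hder : ∀ x, 0 < x → HasDerivAt ψ (2 * θ * (x - u) * (x - (1 - u)) / x) x := by
    intro x hx
    have h := (Real.hasDerivAt_log hx.ne').add ((((hasDerivAt_id x).const_sub 1).pow 2).const_mul θ)
    refine HasDerivAt.congr_deriv h ?_
    simp only [id]
    field_simp
    linear_combination -hu
  have hcont : ∀ s : Set ℝ, (∀ x ∈ s, 0 < x) → ContinuousOn ψ s := fun s hs x hx =>
    (hder x (hs x hx)).continuousAt.continuousWithinAt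
  change ψ v ≤ m θ
  have hmu' : m θ = ψ u := hmu
  rcases le_total v u with hvu | hvu
  · rw [hmu']
    have hs : MonotoneOn ψ (Set.Ioc 0 u) := by
      apply monotoneOn_of_deriv_nonneg (convex_Ioc 0 u) (hcont _ fun x hx => hx.1)
      · intro x hx
        rw [interior_Ioc] at hx
        exact (hder x hx.1).differentiableAt.differentiableWithinAt
      · intro x hx
        rw [interior_Ioc] at hx
        rw [(hder x hx.1).deriv]
        refine div_nonneg ?_ hx.1.le
        rw [mul_assoc]
        exact mul_nonneg (by linarith) (mul_nonneg_of_nonpos_of_nonpos (by linarith [hx.2])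
          (by linarith [hx.2]))
    exact hs ⟨hv0, hvu⟩ ⟨hu0, le_rfl⟩ hvu
  rcases le_total v (1 - u) with hvu' | hvu'
  · rw [hmu']
    have hs : AntitoneOn ψ (Set.Icc u (1 - u)) := by
      apply antitoneOn_of_deriv_nonpos (convex_Icc _ _) (hcont _ fun x hx => hu0.trans_le hx.1)
      · intro x hx
        rw [interior_Icc] at hx
        exact (hder x (hu0.trans hx.1)).differentiableAt.differentiableWithinAt
      · intro x hx
        rw [interior_Icc] at hx
        rw [(hder x (hu0.trans hx.1)).deriv]
        refine div_nonpos_of_nonpos_of_nonneg ?_ (hu0.trans hx.1).le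
        rw [mul_assoc]
        exact mul_nonpos_of_nonneg_of_nonpos (by linarith)
          (mul_nonpos_of_nonneg_of_nonpos (by linarith [hx.1]) (by linarith [hx.2]))
    exact hs ⟨le_rfl, hvu.trans hvu'⟩ ⟨hvu, hvu'⟩ hvu
  · have hs : MonotoneOn ψ (Set.Icc (1 - u) 1) := by
      have hpos : 0 < 1 - u := by linarith
      apply monotoneOn_of_deriv_nonneg (convex_Icc _ _) (hcont _ fun x hx => hpos.trans_le hx.1)
      · intro x hx
        rw [interior_Icc] at hx
        exact (hder x (hpos.trans hx.1)).differentiableAt.differentiableWithinAt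
      · intro x hx
        rw [interior_Icc] at hx
        rw [(hder x (hpos.trans hx.1)).deriv]
        refine div_nonneg ?_ (hpos.trans hx.1).le
        rw [mul_assoc]
        exact mul_nonneg (by linarith) (mul_nonneg (by linarith [hx.1]) (by linarith [hx.1]))
    have h1 : ψ 1 = 0 := by simp [ψ]
    have := hs ⟨hvu', hv1⟩ ⟨by linarith, le_rfl⟩ hv1
    linarith

/-- The excess of the free energy over its value `log (B π e)` without concentration. -/
noncomputable def excess (θ : ℝ) : ℝ := if θ ≤ thetaC then 0 else m θ

lemma freeEnergy_eq (β B : ℝ) :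
    freeEnergy β B = Real.log (B * Real.pi * Real.exp 1) + excess (β * B ^ 2) := by
  unfold freeEnergy excess
  split_ifs <;> simp

lemma excess_nonneg (θ : ℝ) : 0 ≤ excess θ := by
  unfold excess
  split_ifs with h
  · exact le_rfl
  · rw [← thetaC_spec.2.2]
    push Not at h
    exact m_strictMonoOn.monotoneOn two_le_thetaC (two_le_thetaC.trans h.le) h.le

lemma log_add_le_excess {θ v : ℝ} (hv0 : 0 < v) (hv1 : v ≤ 1) :
    Real.log v + θ * (1 - v) ^ 2 ≤ excess θ := by
  unfold excess
  split_ifs with h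
  · have h1 := log_add_le_m le_rfl hv0 hv1
    rw [thetaC_spec.2.2] at h1
    have := mul_le_mul_of_nonneg_right h (sq_nonneg (1 - v))
    linarith
  · exact log_add_le_m (not_le.1 h).le hv0 hv1

section

variable {V : Type*}

/-! ### Bounds on the Hamiltonian -/

lemma continuous_power [Fintype V] : Continuous (power : (V → ℂ) → ℝ) := by
  unfold power
  fun_prop

lemma continuous_edgeEnergy (h : ℝ) (e : Sym2 V) :
    Continuous fun f : V → ℂ => edgeEnergy h f e := by
  induction e with
  | h x y =>
    simp only [edgeEnergy, Sym2.lift_mk]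
    fun_prop

lemma edgeEnergy_nonneg (h : ℝ) (f : V → ℂ) (e : Sym2 V) : 0 ≤ edgeEnergy h f e := by
  induction e with
  | h x y =>
    simp only [edgeEnergy, Sym2.lift_mk]
    positivity

variable [Fintype V]

lemma continuous_hamiltonian (G : SimpleGraph V) [Fintype G.edgeSet] (h : ℝ) :
    Continuous (hamiltonian G h) := by
  have := continuous_edgeEnergy (V := V) h
  unfold hamiltonian
  fun_prop

lemma isCompact_power_le (R : ℝ) : IsCompact {f : V → ℂ | power f ≤ R} := by
  refine Metric.isCompact_of_isClosed_isBounded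
    (isClosed_le continuous_power continuous_const) ?_
  refine (Metric.isBounded_closedBall (x := (0 : V → ℂ)) (r := √R)).subset fun f hf => ?_
  rw [mem_closedBall_zero_iff, pi_norm_le_iff_of_nonneg (Real.sqrt_nonneg R)]
  intro x
  apply Real.le_sqrt_of_sq_le
  exact (Finset.single_le_sum (f := fun x => ‖f x‖ ^ 2) (fun i _ => by positivity)
    (Finset.mem_univ x)).trans hf

lemma integrableOn_exp_hamiltonian (G : SimpleGraph V) [Fintype G.edgeSet] (h β R : ℝ) :
    IntegrableOn (fun f : V → ℂ => Real.exp (-β * hamiltonian G h f)) {f | power f ≤ R} := by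
  have := continuous_hamiltonian G h
  exact (by fun_prop : Continuous fun f : V → ℂ =>
    Real.exp (-β * hamiltonian G h f)).continuousOn.integrableOn_compact (isCompact_power_le R)

/-- Discarding the kinetic energy, which is nonnegative. -/
lemma neg_mul_hamiltonian_le (G : SimpleGraph V) [Fintype G.edgeSet] (h : ℝ) {β : ℝ}
    (hβ : 0 ≤ β) (f : V → ℂ) :
    -β * hamiltonian G h f ≤ β / Fintype.card V * ∑ x, ‖f x‖ ^ 4 := by
  have h1 : 0 ≤ 2 / (Fintype.card V : ℝ) * ∑ e ∈ G.edgeFinset, edgeEnergy h f e :=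
    mul_nonneg (by positivity) (Finset.sum_nonneg fun e _ => edgeEnergy_nonneg h f e)
  unfold hamiltonian
  have := mul_nonneg hβ h1
  calc _ = β / Fintype.card V * ∑ x, ‖f x‖ ^ 4
        - β * (2 / (Fintype.card V : ℝ) * ∑ e ∈ G.edgeFinset, edgeEnergy h f e) := by ring
    _ ≤ _ := by linarith

lemma edgeEnergy_le [DecidableEq V] {h : ℝ} (f : V → ℂ) {e : Sym2 V} (he : ¬ e.IsDiag) :
    edgeEnergy h f e ≤ 2 / h ^ 2 * ∑ x, if x ∈ e then ‖f x‖ ^ 2 else 0 := by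
  induction e with
  | h x y =>
    have hxy : x ≠ y := by simpa using he
    have hsum : (∑ z, if z ∈ s(x, y) then ‖f z‖ ^ 2 else 0) = ‖f x‖ ^ 2 + ‖f y‖ ^ 2 := by
      rw [← Finset.sum_filter, ← Finset.sum_pair (f := fun z => ‖f z‖ ^ 2) hxy]
      congr 1
      ext z
      simp
    rw [hsum]
    simp only [edgeEnergy, Sym2.lift_mk, norm_div, Complex.norm_real, div_pow, Real.norm_eq_abs,
      sq_abs]
    rw [div_mul_eq_mul_div]
    have h1 : ‖f x - f y‖ ≤ ‖f x‖ + ‖f y‖ := norm_sub_le _ _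
    have h2 : ‖f x - f y‖ ^ 2 ≤ 2 * (‖f x‖ ^ 2 + ‖f y‖ ^ 2) := by
      nlinarith [norm_nonneg (f x - f y), sq_nonneg (‖f x‖ - ‖f y‖)]
    gcongr

/-- The kinetic energy is controlled by the power and the maximum degree. -/
lemma sum_edgeEnergy_le [DecidableEq V] (G : SimpleGraph V) [DecidableRel G.Adj] {D : ℕ}
    (hD : G.maxDegree ≤ D) (h : ℝ) (f : V → ℂ) :
    ∑ e ∈ G.edgeFinset, edgeEnergy h f e ≤ 2 / h ^ 2 * (D * power f) := by
  calc ∑ e ∈ G.edgeFinset, edgeEnergy h f e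
      ≤ ∑ e ∈ G.edgeFinset, 2 / h ^ 2 * ∑ x, if x ∈ e then ‖f x‖ ^ 2 else 0 :=
        Finset.sum_le_sum fun e he => edgeEnergy_le f
          (G.not_isDiag_of_mem_edgeSet (SimpleGraph.mem_edgeFinset.1 he))
    _ = 2 / h ^ 2 * ∑ x, (G.degree x : ℝ) * ‖f x‖ ^ 2 := by
        rw [← Finset.mul_sum, Finset.sum_comm]
        congr 1
        refine Finset.sum_congr rfl fun x _ => ?_
        rw [← Finset.sum_filter, Finset.sum_const, ← SimpleGraph.incidenceFinset_eq_filter,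
          SimpleGraph.card_incidenceFinset_eq_degree, nsmul_eq_mul]
    _ ≤ 2 / h ^ 2 * (D * power f) := by
        rw [power, Finset.mul_sum _ _ (D : ℝ)]
        refine mul_le_mul_of_nonneg_left (Finset.sum_le_sum fun x _ => ?_)
          (show 0 ≤ 2 / h ^ 2 by positivity)
        have : G.degree x ≤ D := (G.degree_le_maxDegree x).trans hD
        gcongr

lemma le_neg_mul_hamiltonian [DecidableEq V] [Nonempty V] (G : SimpleGraph V) [DecidableRel G.Adj]
    {D : ℕ} (hD : G.maxDegree ≤ D) (h : ℝ) {β B : ℝ} (hβ : 0 ≤ β) {f : V → ℂ}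
    (hf : power f ≤ B * Fintype.card V) :
    β / Fintype.card V * ∑ x, ‖f x‖ ^ 4 - 4 * D * B * β / h ^ 2 ≤ -β * hamiltonian G h f := by
  have hn : (0 : ℝ) < Fintype.card V := by exact_mod_cast Fintype.card_pos
  have h1 := sum_edgeEnergy_le G hD h f
  have h2 : 2 / (Fintype.card V : ℝ) * ∑ e ∈ G.edgeFinset, edgeEnergy h f e
      ≤ 4 * D * B / h ^ 2 := by
    calc _ ≤ 2 / (Fintype.card V : ℝ) * (2 / h ^ 2 * (D * (B * Fintype.card V))) := by
          refine mul_le_mul_of_nonneg_left (h1.trans ?_) (by positivity)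
          gcongr
      _ = 4 * D * B / h ^ 2 := by
          field_simp
          ring
  have h3 := mul_le_mul_of_nonneg_left h2 hβ
  unfold hamiltonian
  calc _ = β / Fintype.card V * ∑ x, ‖f x‖ ^ 4 - β * (4 * D * B / h ^ 2) := by ring
    _ ≤ β / Fintype.card V * ∑ x, ‖f x‖ ^ 4
        - β * (2 / (Fintype.card V : ℝ) * ∑ e ∈ G.edgeFinset, edgeEnergy h f e) := by linarith
    _ = _ := by ring

/-! ### The upper bound -/

lemma integral_exp_neg_mul_norm_sq {c : ℝ} (hc : 0 < c) :
    ∫ z : ℂ, Real.exp (-c * ‖z‖ ^ 2) = Real.pi / c := by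
  rw [GaussianFourier.integral_rexp_neg_mul_sq_norm hc]
  simp [Complex.finrank_real_complex]

lemma integrable_exp_neg_mul_norm_sq {c : ℝ} (hc : 0 < c) :
    Integrable fun z : ℂ => Real.exp (-c * ‖z‖ ^ 2) := by
  apply Integrable.of_integral_ne_zero
  rw [integral_exp_neg_mul_norm_sq hc]
  positivity

lemma integrable_gaussian {c : V → ℝ} (hc : ∀ x, 0 < c x) :
    Integrable fun f : V → ℂ => Real.exp (-∑ x, c x * ‖f x‖ ^ 2) := by
  have := Integrable.fintype_prod fun x => integrable_exp_neg_mul_norm_sq (hc x)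
  simp only [← Real.exp_sum, neg_mul, Finset.sum_neg_distrib] at this
  exact this

lemma integral_gaussian_eq {c : V → ℝ} (hc : ∀ x, 0 < c x) :
    ∫ f : V → ℂ, Real.exp (-∑ x, c x * ‖f x‖ ^ 2) = ∏ x, Real.pi / c x := by
  have := integral_fintype_prod_volume_eq_prod fun (x : V) (z : ℂ) => Real.exp (-c x * ‖z‖ ^ 2)
  simp only [integral_exp_neg_mul_norm_sq (hc _)] at this
  simpa only [← Real.exp_sum, neg_mul, Finset.sum_neg_distrib] using this

/-- The rates of the Gaussian weight adapted to fields with a light fraction `u` of the power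
outside `S`. -/
noncomputable def gaussianRate [DecidableEq V] (B u : ℝ) (S : Finset V) (x : V) : ℝ :=
  if x ∈ S then (B * Fintype.card V)⁻¹ else (B * u)⁻¹

lemma gaussianRate_pos [DecidableEq V] [Nonempty V] {B u : ℝ} (hB : 0 < B) (hu : 0 < u)
    (S : Finset V) (x : V) : 0 < gaussianRate B u S x := by
  have hn : (0 : ℝ) < Fintype.card V := by exact_mod_cast Fintype.card_pos
  unfold gaussianRate
  split_ifs <;> positivity

lemma prod_pi_div_gaussianRate [DecidableEq V] (B u : ℝ) (S : Finset V) :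
    ∏ x, Real.pi / gaussianRate B u S x
      = (Real.pi * B) ^ Fintype.card V * (Fintype.card V : ℝ) ^ S.card
        * u ^ (Fintype.card V - S.card) := by
  have h1 : ∀ x, Real.pi / gaussianRate B u S x
      = (Real.pi * B) * ((if x ∈ S then (Fintype.card V : ℝ) else 1)
        * (if x ∈ Sᶜ then u else 1)) := by
    intro x
    unfold gaussianRate
    by_cases hx : x ∈ S <;> simp [hx, div_eq_mul_inv] <;> ring
  rw [Finset.prod_congr rfl fun x _ => h1 x, Finset.prod_mul_distrib, Finset.prod_const,
    Finset.prod_mul_distrib, Finset.prod_ite_mem, Finset.prod_ite_mem, Finset.prod_const,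
    Finset.prod_const, Finset.univ_inter, Finset.univ_inter, Finset.card_compl, Finset.card_univ]
  ring

lemma sum_gaussianRate [DecidableEq V] (B u : ℝ) (S : Finset V) (f : V → ℂ) :
    ∑ x, gaussianRate B u S x * ‖f x‖ ^ 2
      = (B * Fintype.card V)⁻¹ * ∑ x ∈ S, ‖f x‖ ^ 2
        + (B * u)⁻¹ * (power f - ∑ x ∈ S, ‖f x‖ ^ 2) := by
  have h1 : power f - ∑ x ∈ S, ‖f x‖ ^ 2 = ∑ x ∈ Sᶜ, ‖f x‖ ^ 2 := by
    rw [power, ← Finset.sum_add_sum_compl S]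
    ring
  rw [h1, ← Finset.sum_add_sum_compl S, Finset.mul_sum, Finset.mul_sum]
  congr 1
  · refine Finset.sum_congr rfl fun x hx => ?_
    simp [gaussianRate, hx]
  · refine Finset.sum_congr rfl fun x hx => ?_
    rw [Finset.mem_compl] at hx
    simp [gaussianRate, hx]

/-- At most `k` sites carry more than `1 / (k + 1)` of the available power. -/
lemma exists_card_eq_forall_le [DecidableEq V] {R : ℝ} {f : V → ℂ} (hf : power f ≤ R) {k : ℕ}
    (hk : k ≤ Fintype.card V) :
    ∃ S : Finset V, S.card = k ∧ ∀ x ∉ S, ‖f x‖ ^ 2 ≤ R / (k + 1) := by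
  set T : Finset V := {x | R / (k + 1) < ‖f x‖ ^ 2} with hT
  have hcard : T.card ≤ k := by
    by_contra! hlt
    have hne : T.Nonempty := Finset.card_pos.1 (by omega)
    have hR : 0 ≤ R := le_trans (Finset.sum_nonneg fun x _ => by positivity) hf
    have h1 : ∑ x ∈ T, R / (k + 1) < ∑ x ∈ T, ‖f x‖ ^ 2 :=
      Finset.sum_lt_sum_of_nonempty hne fun x hx => (Finset.mem_filter.1 hx).2
    have h2 : ∑ x ∈ T, ‖f x‖ ^ 2 ≤ power f :=
      Finset.sum_le_sum_of_subset_of_nonneg (Finset.subset_univ T) fun x _ _ => by positivity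
    have h3 : (k + 1 : ℝ) * (R / (k + 1)) ≤ ∑ x ∈ T, R / (k + 1) := by
      rw [Finset.sum_const, nsmul_eq_mul]
      gcongr
      exact_mod_cast hlt
    rw [mul_div_cancel₀ _ (by positivity)] at h3
    linarith
  obtain ⟨S, hTS, hS⟩ := Finset.exists_superset_card_eq hcard hk
  refine ⟨S, hS, fun x hx => ?_⟩
  by_contra! hlt
  exact hx (hTS (by simp [hT, hlt]))

/-- A field of power at most `B n` has, for some `S` and some `u = 1 - j / n`, its Boltzmann factor
bounded by a Gaussian weight: `S` holds the heavy sites, and `j` counts the power on `S` in units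
of `B`. -/
lemma exists_exp_le_gaussian [DecidableEq V] [Nonempty V] {β B : ℝ} (hβ : 0 ≤ β) (hB : 0 < B)
    {k : ℕ} (hk : k ≤ Fintype.card V) {f : V → ℂ} (hf : power f ≤ B * Fintype.card V) :
    ∃ S ∈ Finset.powersetCard k (Finset.univ : Finset V), ∃ j ∈ Finset.range (Fintype.card V),
      β / Fintype.card V * ∑ x, ‖f x‖ ^ 4
        ≤ Fintype.card V * (β * B ^ 2) * (1 - (1 - (j : ℝ) / Fintype.card V)) ^ 2
          + 3 * (β * B ^ 2) + Fintype.card V * (β * B ^ 2) / (k + 1) + Fintype.card V + 1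
          + -∑ x, gaussianRate B (1 - (j : ℝ) / Fintype.card V) S x * ‖f x‖ ^ 2 := by
  obtain ⟨S, hS, hsmall⟩ := exists_card_eq_forall_le hf hk
  have hcard : 0 < Fintype.card V := Fintype.card_pos
  set A := ∑ x ∈ S, ‖f x‖ ^ 2 with hA
  have hA0 : 0 ≤ A := Finset.sum_nonneg fun x _ => by positivity
  have hAf : A ≤ power f :=
    Finset.sum_le_sum_of_subset_of_nonneg (Finset.subset_univ S) fun x _ _ => by positivity
  have hcompl : power f - A = ∑ x ∈ Sᶜ, ‖f x‖ ^ 2 := by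
    rw [power, ← Finset.sum_add_sum_compl S]
    ring
  -- the truncation at `n - 1` keeps `u` positive when all the power is on `S`
  obtain ⟨j, hjn, hj1, hj2⟩ : ∃ j < Fintype.card V, B * j ≤ A ∧ A ≤ B * (j + 1) := by
    by_cases hlt : ⌊A / B⌋₊ < Fintype.card V
    · refine ⟨_, hlt, ?_, ?_⟩
      · have := Nat.floor_le (div_nonneg hA0 hB.le)
        rwa [le_div_iff₀' hB] at this
      · have := (Nat.lt_floor_add_one (A / B)).le
        rwa [div_le_iff₀' hB] at this
    · push Not at hlt
      have h1 := (Nat.le_floor_iff (div_nonneg hA0 hB.le)).1 hlt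
      rw [le_div_iff₀' hB] at h1
      refine ⟨Fintype.card V - 1, by omega, ?_, ?_⟩ <;> push_cast [Nat.cast_sub hcard]
      · linarith
      · linarith
  refine ⟨S, by simp [Finset.mem_powersetCard, hS], j, by simpa using hjn, ?_⟩
  rw [sum_gaussianRate, ← hA]
  have hquart : ∑ x, ‖f x‖ ^ 4 ≤ A ^ 2 + (B * Fintype.card V) ^ 2 / (k + 1) := by
    rw [← Finset.sum_add_sum_compl S]
    refine add_le_add ?_ ?_
    · calc ∑ x ∈ S, ‖f x‖ ^ 4 ≤ ∑ x ∈ S, ‖f x‖ ^ 2 * A := by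
            refine Finset.sum_le_sum fun x hx => ?_
            have : ‖f x‖ ^ 2 ≤ A :=
              Finset.single_le_sum (f := fun x => ‖f x‖ ^ 2) (fun i _ => by positivity) hx
            nlinarith [sq_nonneg ‖f x‖]
        _ = A ^ 2 := by rw [← Finset.sum_mul, ← hA, sq]
    · calc ∑ x ∈ Sᶜ, ‖f x‖ ^ 4
          ≤ ∑ x ∈ Sᶜ, ‖f x‖ ^ 2 * (B * Fintype.card V / (k + 1)) := by
            refine Finset.sum_le_sum fun x hx => ?_
            have := hsmall x (Finset.mem_compl.1 hx)
            nlinarith [sq_nonneg ‖f x‖]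
        _ = (power f - A) * (B * Fintype.card V / (k + 1)) := by
            rw [← Finset.sum_mul, hcompl]
        _ ≤ (B * Fintype.card V) * (B * Fintype.card V / (k + 1)) := by
            gcongr
            linarith
        _ = (B * Fintype.card V) ^ 2 / (k + 1) := by ring
  have hjn' : (j : ℝ) + 1 ≤ Fintype.card V := by exact_mod_cast hjn
  have hn : (0 : ℝ) < Fintype.card V := by exact_mod_cast hcard
  generalize (Fintype.card V : ℝ) = n at *
  have hj0 : (0 : ℝ) ≤ j := j.cast_nonneg
  generalize (j : ℝ) = a at *
  have hw1 : (B * n)⁻¹ * A ≤ 1 := by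
    rw [inv_mul_le_iff₀ (by positivity)]
    linarith
  have hw2 : (B * (1 - a / n))⁻¹ * (power f - A) ≤ n := by
    have : 0 < 1 - a / n := by
      rw [sub_pos, div_lt_one hn]
      linarith
    rw [inv_mul_le_iff₀ (by positivity)]
    have : B * (1 - a / n) * n = B * n - B * a := by
      field_simp
    linarith
  have hA2 : A ^ 2 ≤ B ^ 2 * (a ^ 2 + 3 * n) := by
    have h1 : A ^ 2 ≤ (B * (a + 1)) ^ 2 := by gcongr
    have h2 : (a + 1) ^ 2 ≤ a ^ 2 + 3 * n := by nlinarith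
    calc A ^ 2 ≤ B ^ 2 * (a + 1) ^ 2 := by linarith [mul_pow B (a + 1) 2]
      _ ≤ _ := by gcongr
  have hmain : β / n * ∑ x, ‖f x‖ ^ 4
      ≤ β / n * (B ^ 2 * (a ^ 2 + 3 * n) + (B * n) ^ 2 / (k + 1)) := by
    gcongr
    linarith
  have hring : β / n * (B ^ 2 * (a ^ 2 + 3 * n) + (B * n) ^ 2 / (k + 1))
      = n * (β * B ^ 2) * (1 - (1 - a / n)) ^ 2 + 3 * (β * B ^ 2) + n * (β * B ^ 2) / (k + 1) := by
    field_simp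
    ring
  linarith

/-- The entropy of the light part and the energy of the heavy part are in balance up to `K` per
site. -/
lemma pow_mul_exp_le {θ u K : ℝ} (hθ : 0 ≤ θ) (hK : 0 ≤ K) (hu0 : 0 < u) (hu1 : u ≤ 1)
    (h : Real.log u + θ * (1 - u) ^ 2 ≤ K) {k n : ℕ} (hk : k ≤ n) :
    u ^ (n - k) * Real.exp (n * θ * (1 - u) ^ 2) ≤ Real.exp (n * K + k * θ) := by
  rw [← Real.exp_log (pow_pos hu0 _), ← Real.exp_add, Real.exp_le_exp, Real.log_pow,
    Nat.cast_sub hk]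
  have hk' : (k : ℝ) ≤ n := by exact_mod_cast hk
  have h1 : (n - k : ℝ) * (Real.log u + θ * (1 - u) ^ 2) ≤ (n - k : ℝ) * K :=
    mul_le_mul_of_nonneg_left h (by linarith)
  have h2 : (k : ℝ) * (θ * (1 - u) ^ 2) ≤ k * (θ * 1) := by
    gcongr
    nlinarith
  have h3 : 0 ≤ (k : ℝ) * K := by positivity
  linarith

lemma partitionFunction_le [DecidableEq V] [Nonempty V] (G : SimpleGraph V) [Fintype G.edgeSet]
    (h : ℝ) {β B K : ℝ} (hβ : 0 ≤ β) (hB : 0 < B) (hK : 0 ≤ K)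
    (hvar : ∀ u : ℝ, 0 < u → u ≤ 1 → Real.log u + β * B ^ 2 * (1 - u) ^ 2 ≤ K)
    {k : ℕ} (hk : k ≤ Fintype.card V) :
    partitionFunction G h β B ≤ (Fintype.card V : ℝ) ^ k * Fintype.card V *
      ((Real.pi * B) ^ Fintype.card V * (Fintype.card V : ℝ) ^ k
        * Real.exp (Fintype.card V * K + k * (β * B ^ 2)
          + (3 * (β * B ^ 2) + Fintype.card V * (β * B ^ 2) / (k + 1) + Fintype.card V + 1))) := by
  have hcard : 0 < Fintype.card V := Fintype.card_pos
  have hn : (0 : ℝ) < Fintype.card V := by exact_mod_cast hcard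
  set θ := β * B ^ 2 with hθ
  have hθ0 : 0 ≤ θ := by positivity
  let u : ℕ → ℝ := fun j => 1 - (j : ℝ) / Fintype.card V
  have hu0 : ∀ j ∈ Finset.range (Fintype.card V), 0 < u j := by
    intro j hj
    have : (j : ℝ) < Fintype.card V := by exact_mod_cast Finset.mem_range.1 hj
    simp only [u, sub_pos, div_lt_one hn, this]
  have hu1 : ∀ j, u j ≤ 1 := fun j => by
    have : 0 ≤ (j : ℝ) / Fintype.card V := by positivity
    simp only [u]
    linarith
  let c : ℕ → ℝ := fun j => Fintype.card V * θ * (1 - u j) ^ 2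
    + 3 * θ + Fintype.card V * θ / (k + 1) + Fintype.card V + 1
  let g : Finset V → ℕ → (V → ℂ) → ℝ := fun S j f =>
    Real.exp (c j) * Real.exp (-∑ x, gaussianRate B (u j) S x * ‖f x‖ ^ 2)
  have hgint : ∀ S, ∀ j ∈ Finset.range (Fintype.card V), Integrable (g S j) := fun S j hj =>
    (integrable_gaussian (gaussianRate_pos hB (hu0 j hj) S)).const_mul _
  set P := Finset.powersetCard k (Finset.univ : Finset V)
  have hsumint : Integrable fun f => ∑ S ∈ P, ∑ j ∈ Finset.range (Fintype.card V), g S j f :=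
    integrable_finsetSum _ fun S _ => integrable_finsetSum _ (hgint S)
  calc partitionFunction G h β B
      ≤ ∫ f in {f : V → ℂ | power f ≤ B * Fintype.card V},
          ∑ S ∈ P, ∑ j ∈ Finset.range (Fintype.card V), g S j f := by
        refine setIntegral_mono_on (integrableOn_exp_hamiltonian G h β _) hsumint.integrableOn
          (isCompact_power_le _).measurableSet fun f hf => ?_
        obtain ⟨S, hS, j, hj, hle⟩ := exists_exp_le_gaussian hβ hB hk hf
        calc Real.exp (-β * hamiltonian G h f) ≤ g S j f := by
              simp only [g]
              rw [← Real.exp_add, Real.exp_le_exp]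
              exact (neg_mul_hamiltonian_le G h hβ f).trans hle
          _ ≤ ∑ j ∈ Finset.range (Fintype.card V), g S j f :=
              Finset.single_le_sum (f := fun j => g S j f) (fun i _ => by positivity) hj
          _ ≤ _ := Finset.single_le_sum
              (f := fun S => ∑ j ∈ Finset.range (Fintype.card V), g S j f)
              (fun i _ => Finset.sum_nonneg fun i _ => by positivity) hS
    _ ≤ ∫ f, ∑ S ∈ P, ∑ j ∈ Finset.range (Fintype.card V), g S j f := by
        refine setIntegral_le_integral hsumint (ae_of_all _ fun f => ?_)
        exact Finset.sum_nonneg fun i _ => Finset.sum_nonneg fun i _ => by positivity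
    _ = ∑ S ∈ P, ∑ j ∈ Finset.range (Fintype.card V), ∫ f, g S j f := by
        rw [integral_finsetSum _ fun S _ => integrable_finsetSum _ (hgint S)]
        exact Finset.sum_congr rfl fun S _ => integral_finsetSum _ (hgint S)
    _ ≤ ∑ S ∈ P, ∑ j ∈ Finset.range (Fintype.card V),
          ((Real.pi * B) ^ Fintype.card V * (Fintype.card V : ℝ) ^ k
            * Real.exp (Fintype.card V * K + k * θ
              + (3 * θ + Fintype.card V * θ / (k + 1) + Fintype.card V + 1))) := by
        refine Finset.sum_le_sum fun S hS => Finset.sum_le_sum fun j hj => ?_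
        have hSk : S.card = k := (Finset.mem_powersetCard.1 hS).2
        simp only [g]
        rw [integral_const_mul, integral_gaussian_eq (gaussianRate_pos hB (hu0 j hj) S),
          prod_pi_div_gaussianRate, hSk]
        have key := pow_mul_exp_le hθ0 hK (hu0 j hj) (hu1 j) (hvar _ (hu0 j hj) (hu1 j)) hk
        have hc : c j = Fintype.card V * θ * (1 - u j) ^ 2
            + (3 * θ + Fintype.card V * θ / (k + 1) + Fintype.card V + 1) := by
          simp only [c]
          ring
        rw [hc, Real.exp_add (_ * _),
          Real.exp_add (Fintype.card V * K + k * θ)]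
        calc _ = (Real.pi * B) ^ Fintype.card V * (Fintype.card V : ℝ) ^ k
              * ((u j ^ (Fintype.card V - k)
                * Real.exp (Fintype.card V * θ * (1 - u j) ^ 2))
              * Real.exp (3 * θ + Fintype.card V * θ / (k + 1) + Fintype.card V + 1)) := by ring
          _ ≤ _ := by
              have := Real.pi_pos
              gcongr
    _ ≤ _ := by
        rw [Finset.sum_const, Finset.sum_const, nsmul_eq_mul, nsmul_eq_mul, Finset.card_range,
          Finset.card_powersetCard, Finset.card_univ, ← mul_assoc]
        have := Real.pi_pos
        gcongr
        exact_mod_cast Nat.choose_le_pow _ _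

end

section

variable {V : Type*} [Fintype V]

/-! ### The lower bound -/

lemma volume_real_power_le [Nonempty V] {R : ℝ} (hR : 0 ≤ R) :
    volume.real {f : V → ℂ | power f ≤ R}
      = (Real.pi * R) ^ Fintype.card V / (Fintype.card V).factorial := by
  have h := Complex.volume_sum_rpow_le V (p := 2) one_le_two (√R)
  have hset : {f : V → ℂ | (∑ i, ‖f i‖ ^ (2 : ℝ)) ^ (1 / (2 : ℝ)) ≤ √R}
      = {f : V → ℂ | power f ≤ R} := by
    ext f
    simp only [Set.mem_ofPred_eq, ← Real.sqrt_eq_rpow, Real.rpow_two]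
    exact Real.sqrt_le_sqrt_iff hR
  rw [hset] at h
  have h2 : (2 : ℝ) / 2 + 1 = 1 + 1 := by norm_num
  have hΓ : Real.Gamma (2 * (Fintype.card V : ℝ) / 2 + 1) = (Fintype.card V).factorial := by
    rw [mul_div_cancel_left₀ _ two_ne_zero, Real.Gamma_nat_eq_factorial]
  rw [h2, Real.Gamma_add_one one_ne_zero, Real.Gamma_one, mul_one, mul_one, hΓ] at h
  have hpi := Real.pi_pos
  rw [measureReal_def, h, ENNReal.toReal_mul, ENNReal.toReal_pow,
    ENNReal.toReal_ofReal (Real.sqrt_nonneg R), ENNReal.toReal_ofReal (by positivity), pow_mul,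
    Real.sq_sqrt hR, mul_pow]
  ring

lemma log_factorial_le {n : ℕ} (hn : 1 ≤ n) :
    Real.log n.factorial ≤ n * Real.log n - n + Real.log n + 1 := by
  induction n, hn using Nat.le_induction with
  | base => simp
  | succ n hn ih =>
    have h0 : (0 : ℝ) < n := by exact_mod_cast hn
    rw [Nat.factorial_succ, Nat.cast_mul, Real.log_mul (by positivity) (by positivity)]
    have h1 := Real.one_sub_inv_le_log_of_pos (x := ((n : ℝ) + 1) / n) (by positivity)
    rw [Real.log_div (by positivity) h0.ne', inv_div] at h1
    have h2 : ((n : ℝ) + 1) * (1 - n / (n + 1)) = 1 := by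
      field_simp
      ring
    have h3 := mul_le_mul_of_nonneg_left h1 (show (0 : ℝ) ≤ n + 1 by positivity)
    push_cast
    linarith

lemma exp_mul_volume_le_partitionFunction (G : SimpleGraph V) [Fintype G.edgeSet] {h β B c : ℝ}
    {T : Set (V → ℂ)} (hT : MeasurableSet T) (hTB : ∀ f ∈ T, power f ≤ B * Fintype.card V)
    (hc : ∀ f ∈ T, c ≤ -β * hamiltonian G h f) :
    Real.exp c * volume.real T ≤ partitionFunction G h β B := by
  have hint := integrableOn_exp_hamiltonian G h β (B * Fintype.card V)
  refine (setIntegral_ge_of_const_le_real hT ?_ (fun f hf => Real.exp_le_exp.2 (hc f hf))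
    (hint.mono_set hTB)).trans ?_
  · exact ((measure_mono hTB).trans_lt (isCompact_power_le _).measure_lt_top).ne
  · exact setIntegral_mono_set hint (ae_of_all _ fun f => (Real.exp_pos _).le)
      (Eventually.of_forall hTB)

/-- The uniform regime: the volume of the whole ball already gives `log (B π e)` per site. -/
lemma le_log_partitionFunction_of_ball [DecidableEq V] [Nonempty V] (G : SimpleGraph V)
    [DecidableRel G.Adj] {D : ℕ} (hD : G.maxDegree ≤ D) (h : ℝ) {β B : ℝ} (hβ : 0 ≤ β)
    (hB : 0 < B) :
    0 < partitionFunction G h β B ∧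
    Fintype.card V * Real.log (B * Real.pi * Real.exp 1) - Real.log (Fintype.card V) - 1
      - 4 * D * B * β / h ^ 2 ≤ Real.log (partitionFunction G h β B) := by
  have hcard : 0 < Fintype.card V := Fintype.card_pos
  have hn : (0 : ℝ) < Fintype.card V := by exact_mod_cast hcard
  have hpi := Real.pi_pos
  have key := exp_mul_volume_le_partitionFunction G (h := h) (β := β) (B := B)
    (c := -(4 * D * B * β / h ^ 2)) (isCompact_power_le (B * Fintype.card V)).measurableSet
    (fun f hf => hf) (fun f hf => by
      have := le_neg_mul_hamiltonian G hD h hβ hf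
      have : 0 ≤ β / Fintype.card V * ∑ x, ‖f x‖ ^ 4 := by positivity
      linarith)
  rw [volume_real_power_le (by positivity)] at key
  have hpos : 0 < Real.exp (-(4 * D * B * β / h ^ 2)) *
    ((Real.pi * (B * Fintype.card V)) ^ Fintype.card V / (Fintype.card V).factorial) := by
    positivity
  refine ⟨hpos.trans_le key, ?_⟩
  have hlog := Real.log_le_log hpos key
  rw [Real.log_mul (by positivity) (by positivity), Real.log_exp,
    Real.log_div (by positivity) (by positivity), Real.log_pow,
    Real.log_mul hpi.ne' (by positivity), Real.log_mul hB.ne' hn.ne'] at hlog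
  rw [Real.log_mul (by positivity) (Real.exp_pos 1).ne', Real.log_mul hB.ne' hpi.ne', Real.log_exp]
  have := log_factorial_le hcard
  linarith

/-- A ball is covered by its parts on which a given site carries at most the average power, so one of
these parts has at least a fraction `1 / n` of the volume. -/
lemma exists_site_volume_ge [Nonempty V] {R : ℝ} (hR : 0 ≤ R) :
    ∃ x₀ : V, (Real.pi * (R * Fintype.card V)) ^ Fintype.card V / (Fintype.card V).factorial
        / Fintype.card V
      ≤ volume.real {g : V → ℂ | power g ≤ R * Fintype.card V ∧ ‖g x₀‖ ^ 2 ≤ R} := by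
  have hn : (0 : ℝ) < Fintype.card V := by exact_mod_cast Fintype.card_pos
  by_contra! hlt
  set T : V → Set (V → ℂ) := fun x => {g | power g ≤ R * Fintype.card V ∧ ‖g x‖ ^ 2 ≤ R}
  have hcover : {g : V → ℂ | power g ≤ R * Fintype.card V} ⊆ ⋃ x, T x := by
    intro g hg
    obtain ⟨x, -, hx⟩ := Finset.exists_le_of_sum_le (f := fun x => ‖g x‖ ^ 2) (g := fun _ => R)
      (Finset.univ_nonempty (α := V)) (by
        rw [Finset.sum_const, nsmul_eq_mul, Finset.card_univ, mul_comm]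
        exact hg)
    exact Set.mem_iUnion.2 ⟨x, hg, hx⟩
  have hfin : volume (⋃ x, T x) ≠ ⊤ := by
    refine ((measure_mono (Set.iUnion_subset fun x g hg => ?_)).trans_lt
      (isCompact_power_le (V := V) (R * Fintype.card V)).measure_lt_top).ne
    exact hg.1
  have h1 := (measureReal_mono hcover hfin).trans (measureReal_iUnion_fintype_le T)
  rw [volume_real_power_le (by positivity)] at h1
  have h2 := Finset.sum_lt_sum_of_nonempty (Finset.univ_nonempty (α := V)) fun x _ => hlt x
  rw [Finset.sum_const, nsmul_eq_mul, Finset.card_univ, mul_div_cancel₀ _ hn.ne'] at h2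
  exact h1.not_gt h2

/-- The concentrated regime: adding a peak of power close to `(1 - q) B n` at one site to the fields
of power at most `q B n` gives `log (B π e) + log q + β B² (1 - q)²` per site. -/
lemma le_log_partitionFunction_of_peak [DecidableEq V] (G : SimpleGraph V) [DecidableRel G.Adj]
    {D : ℕ} (hD : G.maxDegree ≤ D) (h : ℝ) {β B q : ℝ} (hβ : 0 ≤ β) (hB : 0 < B) (hq0 : 0 < q)
    (hq1 : q ≤ 1 / 2) (hV : 4 ≤ Fintype.card V) :
    Fintype.card V * (Real.log (B * Real.pi * Real.exp 1) + Real.log q + β * B ^ 2 * (1 - q) ^ 2)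
      - 2 * Real.log (Fintype.card V) - 1 - 8 * (β * B ^ 2) * √(Fintype.card V)
      - 4 * D * B * β / h ^ 2 ≤ Real.log (partitionFunction G h β B) := by
  have hcard : 0 < Fintype.card V := by omega
  have : Nonempty V := Fintype.card_pos_iff.1 hcard
  have hn : (0 : ℝ) < Fintype.card V := by exact_mod_cast hcard
  have hn4 : (4 : ℝ) ≤ Fintype.card V := by exact_mod_cast hV
  have hpi := Real.pi_pos
  obtain ⟨x₀, hx₀⟩ := exists_site_volume_ge (V := V) (R := q * B) (by positivity)
  set n : ℝ := (Fintype.card V : ℝ) with hndef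
  set T₀ : Set (V → ℂ) := {g | power g ≤ q * B * n ∧ ‖g x₀‖ ^ 2 ≤ q * B} with hT₀
  set r := √(q * B) with hr
  set a := √((1 - q) * B * n) with ha
  have hr0 : 0 ≤ r := Real.sqrt_nonneg _
  have ha0 : 0 ≤ a := Real.sqrt_nonneg _
  have hr2 : r ^ 2 = q * B := Real.sq_sqrt (by positivity)
  have ha2 : a ^ 2 = (1 - q) * B * n :=
    Real.sq_sqrt (mul_nonneg (mul_nonneg (by linarith) hB.le) hn.le)
  have hra : 2 * r ≤ a := by
    apply Real.le_sqrt_of_sq_le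
    have h1 : q * B * 4 ≤ q * B * n := by gcongr
    have h2 : q * B * n ≤ (1 - q) * B * n := by
      gcongr
      linarith
    linarith [mul_pow 2 r 2]
  -- the peak height is chosen so that the total power stays below `B n`
  have hs0 : 0 ≤ a - r := by linarith
  set p : V → ℂ := Pi.single x₀ ((a - r : ℝ) : ℂ) with hp
  set T : Set (V → ℂ) := (fun f => -p + f) ⁻¹' T₀ with hT
  have hT₀meas : MeasurableSet T₀ := by
    have hcont : Continuous fun g : V → ℂ => ‖g x₀‖ ^ 2 := by fun_prop
    exact ((isClosed_le continuous_power continuous_const).inter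
      (isClosed_le hcont continuous_const)).measurableSet
  have hTvol : volume.real T = volume.real T₀ := by
    rw [measureReal_def, measureReal_def, hT, measure_preimage_add]
  have hpeak : ∀ f ∈ T, power f ≤ B * n ∧ a - 2 * r ≤ ‖f x₀‖ := by
    intro f hf
    obtain ⟨g, hg, rfl⟩ : ∃ g ∈ T₀, f = p + g := ⟨-p + f, hf, by simp⟩
    have hgr : ‖g x₀‖ ≤ r := Real.le_sqrt_of_sq_le hg.2
    have hpx : ‖p x₀‖ = a - r := by
      rw [hp, Pi.single_eq_same, Complex.norm_real, Real.norm_of_nonneg hs0]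
    constructor
    · have hsum : power (p + g) - power g = ‖(p + g) x₀‖ ^ 2 - ‖g x₀‖ ^ 2 := by
        rw [power, power, ← Finset.sum_sub_distrib]
        refine Finset.sum_eq_single x₀ (fun x _ hx => ?_) (by simp)
        simp [hp, hx]
      have h1 : ‖(p + g) x₀‖ ≤ (a - r) + ‖g x₀‖ := by
        rw [← hpx]
        exact norm_add_le _ _
      have h2 : ‖(p + g) x₀‖ ^ 2 ≤ ((a - r) + ‖g x₀‖) ^ 2 := by gcongr
      have h3 := mul_le_mul_of_nonneg_left hgr hs0
      have h4 := hg.1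
      nlinarith
    · have := norm_sub_le_norm_add (p x₀) (g x₀)
      rw [hpx] at this
      simp only [Pi.add_apply]
      linarith
  have key := exp_mul_volume_le_partitionFunction G (h := h) (β := β) (B := B) (T := T)
    (c := n * (β * B ^ 2 * (1 - q) ^ 2) - 8 * (β * B ^ 2) * √n - 4 * D * B * β / h ^ 2)
    (hT₀meas.preimage (measurable_const_add _)) (fun f hf => (hpeak f hf).1) (fun f hf => by
      refine le_trans ?_ (le_neg_mul_hamiltonian G hD h hβ (hpeak f hf).1)
      have h1 : (a - 2 * r) ^ 4 ≤ ∑ x, ‖f x‖ ^ 4 := by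
        have h2 := (hpeak f hf).2
        have : 0 ≤ a - 2 * r := by linarith
        exact (pow_le_pow_left₀ this h2 4).trans (Finset.single_le_sum
          (f := fun x => ‖f x‖ ^ 4) (fun i _ => by positivity) (Finset.mem_univ x₀))
      have h2 : a ^ 4 - 8 * (a ^ 3 * r) ≤ (a - 2 * r) ^ 4 := by
        have h3 : (a - 2 * r) ^ 4
            = a ^ 4 - 8 * (a ^ 3 * r) + 8 * r ^ 2 * (a ^ 2 + 2 * (a - r) ^ 2) := by ring
        have : 0 ≤ 8 * r ^ 2 * (a ^ 2 + 2 * (a - r) ^ 2) := by positivity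
        linarith
      have h3 : a ^ 3 * r ≤ B ^ 2 * n * √n := by
        have h4 : a ≤ √B * √n := by
          rw [← Real.sqrt_mul hB.le]
          apply Real.sqrt_le_sqrt
          have := mul_pos hB hn
          nlinarith
        have h5 : r ≤ √B := by
          apply Real.sqrt_le_sqrt
          nlinarith
        have h6 : a ^ 2 ≤ B * n := by
          rw [ha2]
          have := mul_pos hB hn
          nlinarith
        calc a ^ 3 * r = a ^ 2 * a * r := by ring
          _ ≤ (B * n) * (√B * √n) * √B := by gcongr
          _ = B * n * √n * (√B) ^ 2 := by ring
          _ = B ^ 2 * n * √n := by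
            rw [Real.sq_sqrt hB.le]
            ring
      have h7 : a ^ 4 = ((1 - q) * B * n) ^ 2 := by
        rw [← ha2]
        ring
      have h8 : β / n * (((1 - q) * B * n) ^ 2 - 8 * (B ^ 2 * n * √n))
          = n * (β * B ^ 2 * (1 - q) ^ 2) - 8 * (β * B ^ 2) * √n := by
        field_simp
      rw [← h8]
      gcongr
      linarith)
  rw [hTvol] at key
  have hpos : 0 < (Real.pi * (q * B * n)) ^ Fintype.card V / (Fintype.card V).factorial / n := by
    positivity
  have hlog := Real.log_le_log (mul_pos (Real.exp_pos _) hpos)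
    ((mul_le_mul_of_nonneg_left hx₀ (Real.exp_pos _).le).trans key)
  rw [Real.log_mul (by positivity) (by positivity), Real.log_exp,
    Real.log_div (by positivity) (by positivity), Real.log_div (by positivity) (by positivity),
    Real.log_pow, Real.log_mul hpi.ne' (by positivity), Real.log_mul (by positivity) hn.ne',
    Real.log_mul hq0.ne' hB.ne'] at hlog
  rw [Real.log_mul (by positivity) (Real.exp_pos 1).ne', Real.log_mul hB.ne' hpi.ne', Real.log_exp]
  have := log_factorial_le hcard
  linarith

end

section

/-! ### Error terms and the free energy -/

lemma sqrt_le_mul_rpow {n : ℝ} (hn : 1 ≤ n) : √n ≤ n * n ^ (-(1 / 5) : ℝ) := by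
  have h0 : 0 < n := by linarith
  rw [Real.sqrt_eq_rpow, ← Real.rpow_one_add' h0.le (by norm_num)]
  exact Real.rpow_le_rpow_of_exponent_le hn (by norm_num)

lemma sqrt_mul_log_le {n : ℝ} (hn : 1 ≤ n) :
    √n * Real.log n ≤ 10 / 3 * (n * n ^ (-(1 / 5) : ℝ)) := by
  have h0 : 0 < n := by linarith
  have h1 := Real.log_le_rpow_div h0.le (show (0 : ℝ) < 3 / 10 by norm_num)
  calc √n * Real.log n ≤ √n * (n ^ (3 / 10 : ℝ) / (3 / 10)) := by gcongr
    _ = 10 / 3 * (n ^ (1 / 2 : ℝ) * n ^ (3 / 10 : ℝ)) := by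
      rw [Real.sqrt_eq_rpow]
      ring
    _ = 10 / 3 * (n * n ^ (-(1 / 5) : ℝ)) := by
      rw [← Real.rpow_add h0, ← Real.rpow_one_add' h0.le (by norm_num)]
      norm_num

variable {V : Type*} [Fintype V] [DecidableEq V]

lemma log_partitionFunction_div_sub_le (G : SimpleGraph V) [DecidableRel G.Adj] {D : ℕ}
    (hD : G.maxDegree ≤ D) (h : ℝ) {β B : ℝ} (hβ : 0 ≤ β) (hB : 0 < B) (hV : 1 ≤ Fintype.card V) :
    Real.log (partitionFunction G h β B) / Fintype.card V - freeEnergy β B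
      ≤ (11 + 5 * (β * B ^ 2)) * (Fintype.card V : ℝ) ^ (-(1 / 5) : ℝ) := by
  have : Nonempty V := Fintype.card_pos_iff.1 hV
  have hpi := Real.pi_pos
  have hZ := (le_log_partitionFunction_of_ball G hD h hβ hB).1
  -- the number `k ≈ √n` of heavy sites balances the errors `k log n` and `n / k`
  have key := partitionFunction_le G h hβ hB (excess_nonneg (β * B ^ 2))
    (fun u hu0 hu1 => log_add_le_excess hu0 hu1) (Nat.sqrt_le_self (Fintype.card V))
  have hk1 : ((Fintype.card V).sqrt : ℝ) ≤ √(Fintype.card V) := Real.nat_sqrt_le_real_sqrt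
  have hk2 : √(Fintype.card V) ≤ (Fintype.card V).sqrt + 1 := Real.real_sqrt_le_nat_sqrt_succ
  have hn : (1 : ℝ) ≤ Fintype.card V := by exact_mod_cast hV
  have hlog := Real.log_le_log hZ key
  rw [Real.log_mul (by positivity) (by positivity), Real.log_mul (by positivity) (by positivity),
    Real.log_mul (by positivity) (by positivity), Real.log_mul (by positivity) (by positivity),
    Real.log_exp, Real.log_pow, Real.log_pow, Real.log_mul hpi.ne' hB.ne'] at hlog
  have e1 := sqrt_le_mul_rpow hn
  have e2 := sqrt_mul_log_le hn
  have hs1 : 1 ≤ √(Fintype.card V : ℝ) := Real.one_le_sqrt.2 hn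
  have hsq : √(Fintype.card V : ℝ) * √(Fintype.card V : ℝ) = Fintype.card V :=
    Real.mul_self_sqrt (by linarith)
  rw [freeEnergy_eq, Real.log_mul (by positivity) (Real.exp_pos 1).ne', Real.log_mul hB.ne' hpi.ne',
    Real.log_exp, sub_le_iff_le_add, div_le_iff₀ (by linarith)]
  have hθ : 0 ≤ β * B ^ 2 := by positivity
  have hln := Real.log_nonneg hn
  generalize β * B ^ 2 = θ at *
  generalize (Fintype.card V).sqrt = k at *
  generalize (Fintype.card V : ℝ) = n at *
  generalize n ^ (-(1 / 5) : ℝ) = y at *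
  have t1 : (k : ℝ) * Real.log n ≤ √n * Real.log n := by gcongr
  have t2 : Real.log n ≤ √n * Real.log n := le_mul_of_one_le_left hln hs1
  have t3 : n * θ / (k + 1) ≤ √n * θ := by
    rw [div_le_iff₀ (by positivity)]
    calc n * θ = √n * θ * √n := by linear_combination -θ * hsq
      _ ≤ _ := by gcongr
  have t4 : (k : ℝ) * θ ≤ √n * θ := by gcongr
  have t5 : 1 * θ ≤ √n * θ := by gcongr
  have t6 : √n * θ ≤ n * y * θ := by gcongr
  linarith

lemma le_log_partitionFunction_div_sub (G : SimpleGraph V) [DecidableRel G.Adj] {D : ℕ}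
    (hD : G.maxDegree ≤ D) (h : ℝ) {β B : ℝ} (hβ : 0 ≤ β) (hB : 0 < B) (hV : 4 ≤ Fintype.card V) :
    -(8 + 8 * (β * B ^ 2)) * (Fintype.card V : ℝ) ^ (-(1 / 5) : ℝ)
        - 4 * D * B * β * ((Fintype.card V : ℝ) * h ^ 2)⁻¹
      ≤ Real.log (partitionFunction G h β B) / Fintype.card V - freeEnergy β B := by
  have : Nonempty V := Fintype.card_pos_iff.1 (by omega)
  have hn : (1 : ℝ) ≤ Fintype.card V := by exact_mod_cast (by omega : 1 ≤ Fintype.card V)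
  have key : Fintype.card V * (Real.log (B * Real.pi * Real.exp 1) + excess (β * B ^ 2))
      - 2 * Real.log (Fintype.card V) - 1 - 8 * (β * B ^ 2) * √(Fintype.card V)
      - 4 * D * B * β / h ^ 2 ≤ Real.log (partitionFunction G h β B) := by
    unfold excess
    split_ifs with hθ
    · have h1 := (le_log_partitionFunction_of_ball G hD h hβ hB).2
      have h2 := Real.log_nonneg hn
      have h3 : 0 ≤ 8 * (β * B ^ 2) * √(Fintype.card V) := by positivity
      linarith
    · have h2 : 2 ≤ β * B ^ 2 := two_le_thetaC.trans (not_le.1 hθ).le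
      rw [m_eq_log_add h2, ← add_assoc]
      exact le_log_partitionFunction_of_peak G hD h hβ hB (lightFraction_pos h2)
        (lightFraction_le_half _) hV
  have e1 := sqrt_le_mul_rpow hn
  have e2 := sqrt_mul_log_le hn
  have hs1 : 1 ≤ √(Fintype.card V : ℝ) := Real.one_le_sqrt.2 hn
  have hln := Real.log_nonneg hn
  have t2 : Real.log (Fintype.card V) ≤ √(Fintype.card V) * Real.log (Fintype.card V) :=
    le_mul_of_one_le_left hln hs1
  have hθ : 0 ≤ β * B ^ 2 := by positivity
  have hh : 4 * D * B * β * ((Fintype.card V : ℝ) * h ^ 2)⁻¹ * Fintype.card V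
      = 4 * D * B * β / h ^ 2 := by
    rw [mul_inv, div_eq_mul_inv]
    field_simp
  rw [freeEnergy_eq, le_sub_iff_add_le, le_div_iff₀ (by linarith), add_mul, sub_mul, hh]
  generalize β * B ^ 2 = θ at *
  generalize (Fintype.card V : ℝ) = n at *
  generalize n ^ (-(1 / 5) : ℝ) = y at *
  have t6 : √n * θ ≤ n * y * θ := by gcongr
  linarith

end

end DiscreteNLS

theorem theorem2p1 :
    -- `θ_c` is the unique zero of `m` on `[2, ∞)`, with its numerical value
    (2 ≤ DiscreteNLS.thetaC ∧ DiscreteNLS.m DiscreteNLS.thetaC = 0 ∧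
      (∀ θ : ℝ, 2 ≤ θ → DiscreteNLS.m θ = 0 → θ = DiscreteNLS.thetaC) ∧
      |DiscreteNLS.thetaC - 2.455407| < 1 / 10 ^ 6) ∧
    -- the bounds at finite size, with `C` depending only on `ε`, `β`, `B`, `D`
    (∀ (β B ε : ℝ) (D : ℕ), 0 ≤ β → 0 < B → 0 < ε → ε < 1 / 5 →
      ∃ C : ℝ, 0 < C ∧
        ∀ (V : Type*) [Fintype V] [DecidableEq V] (G : SimpleGraph V) [DecidableRel G.Adj]
          (h : ℝ), 0 < h → G.maxDegree ≤ D → C < (Fintype.card V : ℝ) →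
          (-C * (Fintype.card V : ℝ) ^ (-(1 / 5) : ℝ) - C * ((Fintype.card V : ℝ) * h ^ 2)⁻¹
            ≤ Real.log (DiscreteNLS.partitionFunction G h β B) / (Fintype.card V : ℝ)
              - DiscreteNLS.freeEnergy β B) ∧
          (β * B ^ 2 ≤ DiscreteNLS.thetaC →
            Real.log (DiscreteNLS.partitionFunction G h β B) / (Fintype.card V : ℝ)
                - DiscreteNLS.freeEnergy β B
              ≤ C * (Fintype.card V : ℝ) ^ (-(1 / 5) + ε : ℝ)
                + C * (Fintype.card V : ℝ) ^ (-(4 * ε / 5) : ℝ)) ∧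
          (DiscreteNLS.thetaC < β * B ^ 2 →
            Real.log (DiscreteNLS.partitionFunction G h β B) / (Fintype.card V : ℝ)
                - DiscreteNLS.freeEnergy β B
              ≤ C * (Fintype.card V : ℝ) ^ (-(1 / 5) + ε : ℝ))) ∧
    -- convergence of the free energy along sequences with `n → ∞` and `n h² → ∞`
    (∀ (β B : ℝ) (D : ℕ), 0 ≤ β → 0 < B →
      ∀ (V : ℕ → Type*) [∀ k, Fintype (V k)] [∀ k, DecidableEq (V k)]
        (G : ∀ k, SimpleGraph (V k)) [∀ k, DecidableRel (G k).Adj] (h : ℕ → ℝ),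
        (∀ k, 0 < h k) → (∀ k, (G k).maxDegree ≤ D) →
        Tendsto (fun k => (Fintype.card (V k) : ℝ)) atTop atTop →
        Tendsto (fun k => (Fintype.card (V k) : ℝ) * h k ^ 2) atTop atTop →
        Tendsto (fun k => Real.log (DiscreteNLS.partitionFunction (G k) (h k) β B)
            / (Fintype.card (V k) : ℝ)) atTop (𝓝 (DiscreteNLS.freeEnergy β B))) := by
  refine ⟨⟨DiscreteNLS.two_le_thetaC, DiscreteNLS.thetaC_spec.2.2,
    fun θ hθ h0 => DiscreteNLS.eq_thetaC_of_m_eq_zero hθ h0, ?_⟩, ?_, ?_⟩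
  · obtain ⟨h1, h2, -⟩ := DiscreteNLS.thetaC_spec
    rw [abs_lt]
    constructor <;> norm_num at h1 h2 ⊢ <;> linarith
  · intro β B ε D hβ hB hε _
    have hθ : 0 ≤ β * B ^ 2 := by positivity
    have hK : 0 ≤ 4 * D * B * β := by positivity
    refine ⟨11 + 8 * (β * B ^ 2) + 4 * D * B * β, by positivity, ?_⟩
    intro V _ _ G _ h hh hD hn
    have hV : 4 ≤ Fintype.card V := by
      have : (4 : ℝ) ≤ Fintype.card V := by linarith
      exact_mod_cast this
    have hn1 : (1 : ℝ) ≤ Fintype.card V := by linarith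
    have hlow := DiscreteNLS.le_log_partitionFunction_div_sub G hD h hβ hB hV
    have hup := DiscreteNLS.log_partitionFunction_div_sub_le G hD h hβ hB (by omega)
    have hpow : (Fintype.card V : ℝ) ^ (-(1 / 5) : ℝ)
        ≤ (Fintype.card V : ℝ) ^ (-(1 / 5) + ε : ℝ) :=
      Real.rpow_le_rpow_of_exponent_le hn1 (by linarith)
    have hup' : Real.log (DiscreteNLS.partitionFunction G h β B) / (Fintype.card V : ℝ)
        - DiscreteNLS.freeEnergy β B ≤ (11 + 8 * (β * B ^ 2) + 4 * D * B * β)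
          * (Fintype.card V : ℝ) ^ (-(1 / 5) + ε : ℝ) := by
      refine hup.trans ?_
      gcongr ?_ * ?_
      linarith
    refine ⟨le_trans ?_ hlow, fun _ => ?_, fun _ => hup'⟩
    · exact sub_le_sub (mul_le_mul_of_nonneg_right (by linarith) (by positivity))
        (mul_le_mul_of_nonneg_right (by linarith) (by positivity))
    · have : 0 ≤ (11 + 8 * (β * B ^ 2) + 4 * D * B * β)
          * (Fintype.card V : ℝ) ^ (-(4 * ε / 5) : ℝ) := by positivity
      linarith
  · intro β B D hβ hB V _ _ G _ h _ hD hn hnh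
    have hpow : Tendsto (fun k => (Fintype.card (V k) : ℝ) ^ (-(1 / 5) : ℝ)) atTop (𝓝 0) :=
      (tendsto_rpow_neg_atTop (by norm_num)).comp hn
    have hlow := (hpow.const_mul (-(8 + 8 * (β * B ^ 2)))).sub
      (hnh.inv_tendsto_atTop.const_mul (4 * D * B * β))
    have hup := hpow.const_mul (11 + 5 * (β * B ^ 2))
    simp only [mul_zero, sub_zero] at hlow hup
    rw [← tendsto_sub_nhds_zero_iff]
    refine tendsto_of_tendsto_of_tendsto_of_le_of_le' hlow hup ?_ ?_
    · filter_upwards [hn.eventually_ge_atTop 4] with k hk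
      exact DiscreteNLS.le_log_partitionFunction_div_sub (G k) (hD k) (h k) hβ hB
        (by exact_mod_cast hk)
    · filter_upwards [hn.eventually_ge_atTop 4] with k hk
      have : 4 ≤ Fintype.card (V k) := by exact_mod_cast hk
      exact DiscreteNLS.log_partitionFunction_div_sub_le (G k) (hD k) (h k) hβ hB (by omega)
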